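/- Let $d\ge 0$, let $\mathcal X\subset\mathbb R^d$ be compact, let $\lambda$ be Lebesgue measure and let $\sigma>0$. Let $\mathscr L^*(\mathcal X)$ be the set of Lebesgue-measurable subsets of $\mathcal X$ modulo the equivalence relation $\lambda(\gamma_1\Delta\gamma_2)=0$, equipped with the metric $\delta(\gamma_1,\gamma_2)=\lambda(\gamma_1\Delta\gamma_2)$ and its Borel $\sigma$-algebra, and put $$k_{set}(\gamma_1,\gamma_2)=\exp\Bigl(-\frac{\lambda(\gamma_1\Delta\gamma_2)}{2\sigma^2}\Bigr),\qquad \gamma_1,\gamma_2\in\mathscr L^*(\mathcal X).$$ Then: 1. $k_{set}$ is integrally strictly positive definite: it is measurable and bounded, and for every nonzero finite signed Borel measure $\nu$ on $\mathscr L^*(\mathcal X)$, $$\int\!\!\int k_{set}(\gamma_1,\gamma_2)\,d\nu(\gamma_2)\,d\nu(\gamma_1)>0.$$ 2. $k_{set}$ is characteristic: it is symmetric and positive definite (that is, $\sum_{i,j}\alpha_i\alpha_j k_{set}(\gamma_i,\gamma_j)\ge 0$ for all finite families $\alpha_i\in\mathbb R$, $\gamma_i\in\mathscr L^*(\mathcal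 X)$), and, writing $\mathcal H$ for its reproducing kernel Hilbert space, the map $\gamma\mapsto k_{set}(\gamma,\cdot)\in\mathcal H$ is Bochner integrable with respect to every Borel probability measure on $\mathscr L^*(\mathcal X)$, and the kernel mean embedding $$P\longmapsto \int k_{set}(\gamma,\cdot)\,dP(\gamma)\in\mathcal H$$ is injective on Borel probability measures on $\mathscr L^*(\mathcal X)$. -/

import Mathlib

open MeasureTheory TopologicalSpace
open scoped symmDiff

noncomputable section

namespace SetKernel

section Kernels

variable {Z : Type*}

/-- A kernel on `Z`: a symmetric and positive definite function `k : Z × Z → ℝ`, where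
positive definite means `∑ i j, α i * α j * k (z i) (z j) ≥ 0` for all finite families of
real coefficients and points. -/
class IsKernel (k : Z → Z → ℝ) : Prop where
  symm : ∀ x y, k x y = k y x
  nonneg : ∀ (n : ℕ) (α : Fin n → ℝ) (z : Fin n → Z),
    0 ≤ ∑ i, ∑ j, α i * α j * k (z i) (z j)

/-- A real-valued function of two variables as a matrix of operators `ℝ →L[ℝ] ℝ`, the form in
which Mathlib's theory of reproducing kernel Hilbert spaces takes kernels. -/
def kernelMatrix (k : Z → Z → ℝ) : Matrix Z Z (ℝ →L[ℝ] ℝ) :=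
  Matrix.of fun x y => k x y • (1 : ℝ →L[ℝ] ℝ)

theorem kernelMatrix_apply (k : Z → Z → ℝ) (x y : Z) (a : ℝ) :
    kernelMatrix k x y a = k x y * a := by
  simp [kernelMatrix]

theorem kernelMatrix_posSemidef (k : Z → Z → ℝ) [hk : IsKernel k] :
    (kernelMatrix k).PosSemidef := by
  have key := (RKHS.posSemidef_tfae (K := kernelMatrix k)).out 0 2
  refine key.mpr ⟨?_, fun v => ?_⟩
  · ext x y
    simp [kernelMatrix, Matrix.conjTranspose_apply, hk.symm x y]
  · have h := hk.nonneg v.support.card (fun i => v (v.support.equivFin.symm i))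
      (fun i => (v.support.equivFin.symm i : Z))
    have e : ∀ g : Z → ℝ, ∑ i, g (v.support.equivFin.symm i : Z) = ∑ x ∈ v.support, g x := by
      intro g
      rw [Equiv.sum_comp v.support.equivFin.symm (fun x : v.support => g x)]
      exact Finset.sum_coe_sort v.support g
    rw [e fun x => ∑ j, v x * v (v.support.equivFin.symm j) *
      k x (v.support.equivFin.symm j)] at h
    rw [Finset.sum_congr rfl fun x _ => e fun y => v x * v y * k x y] at h
    refine h.trans_eq (Finset.sum_congr rfl fun x _ => Finset.sum_congr rfl fun y _ => ?_)
    change _ = inner ℝ (kernelMatrix k y x (v x)) (v y)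
    rw [kernelMatrix_apply, hk.symm x y]
    simp only [RCLike.inner_apply, conj_trivial]
    ring

instance (k : Z → Z → ℝ) [IsKernel k] : Fact (kernelMatrix k).PosSemidef :=
  ⟨kernelMatrix_posSemidef k⟩

/-- The reproducing kernel Hilbert space of the kernel `k`, a complete space of functions
`Z → ℝ`. -/
abbrev KernelRKHS (k : Z → Z → ℝ) [IsKernel k] : Type _ := RKHS.OfKernel (kernelMatrix k)

/-- The canonical feature map `z ↦ k(·, z)` with values in the RKHS. -/
def featureMap (k : Z → Z → ℝ) [IsKernel k] (z : Z) : KernelRKHS k :=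
  RKHS.kerFun (KernelRKHS k) z (1 : ℝ)

/-- The feature at `z` is the function `k(·, z)`. -/
theorem featureMap_apply (k : Z → Z → ℝ) [IsKernel k] (z w : Z) :
    (featureMap k z : Z → ℝ) w = k w z := by
  simp [featureMap, RKHS.kerFun_apply, kernelMatrix_apply]

/-- The reproducing property. -/
theorem inner_featureMap (k : Z → Z → ℝ) [IsKernel k] (f : KernelRKHS k) (z : Z) :
    inner ℝ f (featureMap k z) = (f : Z → ℝ) z := by
  simp [featureMap, RKHS.inner_kerFun]

variable [MeasurableSpace Z]

/-- The kernel mean embedding `P ↦ ∫ k(z, ·) dP(z)` of probability measures in the RKHS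
(a Bochner integral). -/
def meanEmbedding (k : Z → Z → ℝ) [IsKernel k] (P : ProbabilityMeasure Z) : KernelRKHS k :=
  ∫ z, featureMap k z ∂(P : Measure Z)

/-- `k` is characteristic: it is a kernel, its mean embedding is well defined on all probability
measures, and the mean embedding is injective. -/
def IsCharacteristic (k : Z → Z → ℝ) : Prop :=
  ∃ _ : IsKernel k,
    (∀ P : ProbabilityMeasure Z, Integrable (featureMap k) (P : Measure Z)) ∧
    Function.Injective (meanEmbedding k)

/-- `k` is integrally strictly positive definite: it is measurable and bounded, and
`∬ k(x, y) dν(x) dν(y) > 0` for every nonzero finite signed measure `ν`. -/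
structure IsIntegrallyStrictlyPosDef (k : Z → Z → ℝ) : Prop where
  measurable : Measurable (Function.uncurry k)
  bounded : ∃ C : ℝ, ∀ x y, |k x y| ≤ C
  pos : ∀ ν : SignedMeasure Z, ν ≠ 0 → 0 < ∫ᵛ x, (∫ᵛ y, k x y ∂<•ν) ∂<•ν

end Kernels

section Sets

variable {d : ℕ}

/-- The Lebesgue-measurable subsets of the compact set `X ⊆ ℝ^d` (null-measurable sets for
`volume` are the measurable sets of the completed Borel σ-algebra). -/
def LSets (X : Compacts (EuclideanSpace ℝ (Fin d))) : Type :=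
  {γ : Set (EuclideanSpace ℝ (Fin d)) // γ ⊆ X ∧ NullMeasurableSet γ volume}

theorem LSets.volume_symmDiff_ne_top {X : Compacts (EuclideanSpace ℝ (Fin d))}
    (γ₁ γ₂ : LSets X) : volume (γ₁.1 ∆ γ₂.1) ≠ ⊤ := by
  have h : γ₁.1 ∆ γ₂.1 ⊆ X := fun x hx =>
    hx.elim (fun h => γ₁.2.1 h.1) (fun h => γ₂.2.1 h.1)
  exact ((measure_mono h).trans_lt X.isCompact.measure_lt_top).ne

/-- The pseudo-metric `δ(γ₁, γ₂) = λ(γ₁ ∆ γ₂)`. -/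
instance (X : Compacts (EuclideanSpace ℝ (Fin d))) : PseudoMetricSpace (LSets X) where
  dist γ₁ γ₂ := (volume (γ₁.1 ∆ γ₂.1)).toReal
  dist_self γ := by simp
  dist_comm γ₁ γ₂ := by rw [symmDiff_comm]
  dist_triangle γ₁ γ₂ γ₃ := by
    rw [← ENNReal.toReal_add (LSets.volume_symmDiff_ne_top γ₁ γ₂)
      (LSets.volume_symmDiff_ne_top γ₂ γ₃)]
    exact ENNReal.toReal_mono (ENNReal.add_ne_top.2 ⟨LSets.volume_symmDiff_ne_top γ₁ γ₂,
      LSets.volume_symmDiff_ne_top γ₂ γ₃⟩) (measure_symmDiff_le _ _ _)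

theorem LSets.dist_def {X : Compacts (EuclideanSpace ℝ (Fin d))} (γ₁ γ₂ : LSets X) :
    dist γ₁ γ₂ = (volume (γ₁.1 ∆ γ₂.1)).toReal := rfl

/-- The quotient of the Lebesgue-measurable subsets of `X` by the relation `λ(γ₁ ∆ γ₂) = 0`.
It is a metric space for `λ(γ₁ ∆ γ₂)`. -/
abbrev LStar (X : Compacts (EuclideanSpace ℝ (Fin d))) : Type := SeparationQuotient (LSets X)

theorem LStar.mk_eq_mk_iff {X : Compacts (EuclideanSpace ℝ (Fin d))} (γ₁ γ₂ : LSets X) :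
    (SeparationQuotient.mk γ₁ : LStar X) = SeparationQuotient.mk γ₂ ↔
      volume (γ₁.1 ∆ γ₂.1) = 0 := by
  rw [SeparationQuotient.mk_eq_mk, Metric.inseparable_iff, LSets.dist_def,
    ENNReal.toReal_eq_zero_iff, or_iff_left (LSets.volume_symmDiff_ne_top γ₁ γ₂)]

/-- The Borel σ-algebra of the metric space `LStar X`. -/
instance (X : Compacts (EuclideanSpace ℝ (Fin d))) : MeasurableSpace (LStar X) := borel _

instance (X : Compacts (EuclideanSpace ℝ (Fin d))) : BorelSpace (LStar X) := ⟨rfl⟩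

/-- `k_set(γ₁, γ₂) = exp(-λ(γ₁ ∆ γ₂) / (2σ²))`; the metric of `LStar X` is `λ(γ₁ ∆ γ₂)`. -/
def kset (X : Compacts (EuclideanSpace ℝ (Fin d))) (σ : ℝ) (γ₁ γ₂ : LStar X) : ℝ :=
  Real.exp (-dist γ₁ γ₂ / (2 * σ ^ 2))

theorem kset_mk (X : Compacts (EuclideanSpace ℝ (Fin d))) (σ : ℝ) (γ₁ γ₂ : LSets X) :
    kset X σ (SeparationQuotient.mk γ₁) (SeparationQuotient.mk γ₂) =
      Real.exp (-(volume (γ₁.1 ∆ γ₂.1)).toReal / (2 * σ ^ 2)) := rfl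

end Sets

end SetKernel

end

noncomputable section

namespace SetKernel

open ProbabilityTheory

/-! ### Positive definiteness of the Gaussian kernel on an inner product space. -/

section PosDef

variable {H : Type*} [NormedAddCommGroup H] [InnerProductSpace ℝ H]

/-! Indicators map classes of sets into the Hilbert space `L²` with `‖1_A - 1_B‖² = λ(A ∆ B)`, so
`kset` is the pullback of a Gaussian kernel (`kset_eq_gaussianKernel`). The double integral against
`ν` is the squared RKHS distance between the mean elements of the two Jordan parts
(`double_integral_signedMeasure`). Both claims thus reduce to one: a finite measure is determined by
its Gaussian mean element. Pairing with features gives the Gaussian transform of the pushforward to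
`L²`. Up to a factor depending on the centre only, it is the moment generating function of that
measure weighted by `exp (-c ‖x‖²)`. Analytic continuation yields the characteristic function, hence
the measure. -/

theorem posSemidef_gram_pow {n : ℕ} (z : Fin n → H) (m : ℕ) :
    (Matrix.of fun i j => inner ℝ (z i) (z j) ^ m : Matrix (Fin n) (Fin n) ℝ).PosSemidef := by
  induction m with
  | zero =>
    have h := Matrix.posSemidef_gram ℝ (fun _ : Fin n => (1 : ℝ))
    have e : (Matrix.of fun i j => inner ℝ (z i) (z j) ^ 0 : Matrix (Fin n) (Fin n) ℝ) =
        Matrix.gram ℝ fun _ => (1 : ℝ) := by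
      ext i j
      simp
    exact e ▸ h
  | succ m ih =>
    exact ih.hadamard (Matrix.posSemidef_gram ℝ z)

theorem sum_mul_inner_pow_nonneg {n : ℕ} (α : Fin n → ℝ) (z : Fin n → H) (m : ℕ) :
    0 ≤ ∑ i, ∑ j, α i * α j * inner ℝ (z i) (z j) ^ m := by
  have h := (posSemidef_gram_pow z m).dotProduct_mulVec_nonneg α
  refine h.trans_eq ?_
  simp only [dotProduct, Matrix.mulVec, Matrix.of_apply, Pi.star_apply, star_trivial,
    Finset.mul_sum]
  exact Finset.sum_congr rfl fun i _ => Finset.sum_congr rfl fun j _ => by ring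

/-- The exponential series has nonnegative coefficients, and powers of a Gram matrix are positive
semidefinite by the Schur product theorem. -/
theorem sum_mul_exp_inner_nonneg {a : ℝ} (ha : 0 ≤ a) {n : ℕ} (α : Fin n → ℝ) (z : Fin n → H) :
    0 ≤ ∑ i, ∑ j, α i * α j * Real.exp (a * inner ℝ (z i) (z j)) := by
  have hs : HasSum (fun m : ℕ => ∑ i, ∑ j, α i * α j *
      ((a * inner ℝ (z i) (z j)) ^ m / (m.factorial : ℝ)))
      (∑ i, ∑ j, α i * α j * Real.exp (a * inner ℝ (z i) (z j))) := by
    refine hasSum_sum fun i _ => hasSum_sum fun j _ => HasSum.mul_left _ ?_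
    rw [Real.exp_eq_exp_ℝ]
    exact NormedSpace.exp_series_hasSum_exp' (𝕂 := ℝ) (a * inner ℝ (z i) (z j)) |>.congr_fun
      fun m => by simp [div_eq_inv_mul]
  refine hs.nonneg fun m => ?_
  have h := mul_nonneg (div_nonneg (pow_nonneg ha m) (Nat.cast_nonneg (α := ℝ) m.factorial))
    (sum_mul_inner_pow_nonneg α z m)
  refine h.trans_eq ?_
  simp only [Finset.mul_sum]
  exact Finset.sum_congr rfl fun i _ => Finset.sum_congr rfl fun j _ => by rw [mul_pow]; ring

/-- The Gaussian kernel `exp (-c ‖x - y‖²)` of an inner product space. -/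
def gaussianKernel (H : Type*) [NormedAddCommGroup H] [InnerProductSpace ℝ H] (c : ℝ)
    (x y : H) : ℝ :=
  Real.exp (-c * ‖x - y‖ ^ 2)

theorem gaussianKernel_eq (c : ℝ) (x y : H) :
    gaussianKernel H c x y =
      Real.exp (-c * ‖x‖ ^ 2) * Real.exp (-c * ‖y‖ ^ 2) * Real.exp (2 * c * inner ℝ x y) := by
  rw [gaussianKernel, ← Real.exp_add, ← Real.exp_add, norm_sub_sq_real]
  ring_nf

theorem isKernel_gaussianKernel {c : ℝ} (hc : 0 ≤ c) : IsKernel (gaussianKernel H c) where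
  symm x y := by rw [gaussianKernel, gaussianKernel, norm_sub_rev]
  nonneg n α z := by
    have h := sum_mul_exp_inner_nonneg (a := 2 * c) (by positivity)
      (fun i => α i * Real.exp (-c * ‖z i‖ ^ 2)) z
    refine h.trans_eq ?_
    refine Finset.sum_congr rfl fun i _ => Finset.sum_congr rfl fun j _ => ?_
    rw [gaussianKernel_eq]
    ring

theorem IsKernel.comap {Z W : Type*} {k : W → W → ℝ} (hk : IsKernel k) (ι : Z → W) :
    IsKernel fun x y => k (ι x) (ι y) where
  symm _ _ := hk.symm _ _
  nonneg n α z := hk.nonneg n α (ι ∘ z)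

theorem continuous_gaussianKernel (c : ℝ) :
    Continuous (Function.uncurry (gaussianKernel H c)) := by
  unfold gaussianKernel Function.uncurry
  fun_prop

theorem gaussianKernel_le_one {c : ℝ} (hc : 0 ≤ c) (x y : H) : gaussianKernel H c x y ≤ 1 :=
  Real.exp_le_one_iff.2 (by nlinarith [sq_nonneg ‖x - y‖])

theorem gaussianKernel_pos (c : ℝ) (x y : H) : 0 < gaussianKernel H c x y := Real.exp_pos _

end PosDef

/-! ### Continuity and integrability of feature maps. -/

section FeatureMap

variable {Z : Type*} {k : Z → Z → ℝ} [IsKernel k]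

theorem inner_featureMap_featureMap (x y : Z) :
    inner ℝ (featureMap k x) (featureMap k y) = k x y := by
  rw [inner_featureMap, featureMap_apply, IsKernel.symm (k := k)]

theorem norm_featureMap (x : Z) : ‖featureMap k x‖ = √(k x x) := by
  rw [← inner_featureMap_featureMap (k := k), real_inner_self_eq_norm_sq,
    Real.sqrt_sq (norm_nonneg _)]

theorem continuous_featureMap [TopologicalSpace Z] (hk : Continuous (Function.uncurry k)) :
    Continuous (featureMap k) := by
  rw [continuous_iff_continuousAt]
  intro x
  rw [ContinuousAt, tendsto_iff_norm_sub_tendsto_zero]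
  have e : ∀ y, ‖featureMap k y - featureMap k x‖ = √(k y y - 2 * k y x + k x x) := by
    intro y
    rw [← Real.sqrt_sq (norm_nonneg (featureMap k y - featureMap k x)), norm_sub_sq_real,
      inner_featureMap_featureMap, ← real_inner_self_eq_norm_sq, ← real_inner_self_eq_norm_sq,
      inner_featureMap_featureMap, inner_featureMap_featureMap]
  have h1 : Continuous fun y => k y y := hk.comp (continuous_id.prodMk continuous_id)
  have h2 : Continuous fun y => k y x := hk.comp (continuous_id.prodMk continuous_const)
  have h : Continuous fun y => √(k y y - 2 * k y x + k x x) := by fun_prop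
  have := h.tendsto x
  simp only [e]
  convert this using 2
  rw [eq_comm, Real.sqrt_eq_zero']
  linarith

theorem integrable_featureMap_comp {W : Type*} [TopologicalSpace W] [SecondCountableTopology W]
    [MeasurableSpace W] [OpensMeasurableSpace W] [TopologicalSpace Z]
    (hk : Continuous (Function.uncurry k)) {C : ℝ}
    (hC : ∀ x, k x x ≤ C) {ι : W → Z} (hι : Continuous ι) (P : Measure W) [IsFiniteMeasure P] :
    Integrable (fun w => featureMap k (ι w)) P := by
  refine Integrable.of_bound ((continuous_featureMap hk).comp hι).aestronglyMeasurable (√C)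
    (Filter.Eventually.of_forall fun w => ?_)
  rw [norm_featureMap]
  exact Real.sqrt_le_sqrt (hC _)

end FeatureMap

/-! ### Mean elements and double integrals. -/

section MeanElement

variable {Z V W : Type*} [MeasurableSpace Z]
  [NormedAddCommGroup V] [InnerProductSpace ℝ V] [CompleteSpace V]
  [NormedAddCommGroup W] [InnerProductSpace ℝ W] [CompleteSpace W]
  {P Q : Measure Z} {Φ : Z → V}

theorem integral_inner_sub_integral_inner (hP : Integrable Φ P) (hQ : Integrable Φ Q) (v : V) :
    ∫ y, inner ℝ v (Φ y) ∂P - ∫ y, inner ℝ v (Φ y) ∂Q =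
      inner ℝ v (∫ y, Φ y ∂P - ∫ y, Φ y ∂Q) := by
  rw [integral_inner hP, integral_inner hQ, inner_sub_right]

theorem double_integral_inner (hP : Integrable Φ P) (hQ : Integrable Φ Q) :
    ∫ x, (∫ y, inner ℝ (Φ x) (Φ y) ∂P - ∫ y, inner ℝ (Φ x) (Φ y) ∂Q) ∂P -
      ∫ x, (∫ y, inner ℝ (Φ x) (Φ y) ∂P - ∫ y, inner ℝ (Φ x) (Φ y) ∂Q) ∂Q =
      ‖∫ y, Φ y ∂P - ∫ y, Φ y ∂Q‖ ^ 2 := by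
  simp only [integral_inner_sub_integral_inner hP hQ]
  set m := ∫ y, Φ y ∂P - ∫ y, Φ y ∂Q with hm
  simp only [fun x => real_inner_comm m (Φ x)]
  rw [integral_inner_sub_integral_inner hP hQ, ← hm, real_inner_self_eq_norm_sq]

/-- The distance between two mean elements depends only on the kernel, so equality passes from one
feature map of the kernel to any other. -/
theorem integral_eq_integral_of_inner_eq {Ψ : Z → W}
    (hΦP : Integrable Φ P) (hΦQ : Integrable Φ Q) (hΨP : Integrable Ψ P) (hΨQ : Integrable Ψ Q)
    (h : ∀ x y, inner ℝ (Φ x) (Φ y) = inner ℝ (Ψ x) (Ψ y))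
    (he : ∫ x, Φ x ∂P = ∫ x, Φ x ∂Q) : ∫ x, Ψ x ∂P = ∫ x, Ψ x ∂Q := by
  have h1 := double_integral_inner hΦP hΦQ
  have h2 := double_integral_inner hΨP hΨQ
  simp only [h] at h1
  rw [h1, he, sub_self, norm_zero] at h2
  exact sub_eq_zero.1 (norm_eq_zero.1 (pow_eq_zero_iff two_ne_zero |>.1 (by simpa using h2.symm)))

theorem integral_signedMeasure_eq {G : Type*} [NormedAddCommGroup G] [NormedSpace ℝ G]
    (ν : SignedMeasure Z) {f : Z → G}
    (hP : Integrable f ν.toJordanDecomposition.posPart)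
    (hQ : Integrable f ν.toJordanDecomposition.negPart) :
    ∫ᵛ x, f x ∂<•ν = ∫ x, f x ∂ν.toJordanDecomposition.posPart -
      ∫ x, f x ∂ν.toJordanDecomposition.negPart := by
  conv_lhs => rw [← ν.toSignedMeasure_toJordanDecomposition]
  rw [JordanDecomposition.toSignedMeasure, VectorMeasure.integral_sub_vectorMeasure,
    VectorMeasure.integral_toSignedMeasure, VectorMeasure.integral_toSignedMeasure]
  · simpa [VectorMeasure.Integrable] using hP
  · simpa [VectorMeasure.Integrable] using hQ

theorem double_integral_signedMeasure (ν : SignedMeasure Z)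
    (hP : Integrable Φ ν.toJordanDecomposition.posPart)
    (hQ : Integrable Φ ν.toJordanDecomposition.negPart) :
    ∫ᵛ x, (∫ᵛ y, inner ℝ (Φ x) (Φ y) ∂<•ν) ∂<•ν =
      ‖∫ y, Φ y ∂ν.toJordanDecomposition.posPart -
        ∫ y, Φ y ∂ν.toJordanDecomposition.negPart‖ ^ 2 := by
  rw [← double_integral_inner hP hQ]
  have e : ∀ x, ∫ᵛ y, inner ℝ (Φ x) (Φ y) ∂<•ν = _ := fun x =>
    integral_signedMeasure_eq ν (hP.const_inner (𝕜 := ℝ) (Φ x)) (hQ.const_inner (𝕜 := ℝ) (Φ x))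
  simp only [e]
  refine integral_signedMeasure_eq ν ?_ ?_ <;>
    simp only [integral_inner_sub_integral_inner hP hQ]
  · exact hP.inner_const _
  · exact hQ.inner_const _

end MeanElement

/-! ### Finite measures determined by their Gaussian transforms. -/

section Injectivity

variable {H : Type*} [NormedAddCommGroup H] [InnerProductSpace ℝ H] [CompleteSpace H]
  [SecondCountableTopology H] [MeasurableSpace H] [BorelSpace H]

theorem _root_.MeasureTheory.Measure.ext_of_integral_exp_inner {P Q : Measure H}
    [IsFiniteMeasure P] [IsFiniteMeasure Q]
    (hP : ∀ f : H, Integrable (fun x => Real.exp (inner ℝ x f)) P)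
    (h : ∀ f : H, ∫ x, Real.exp (inner ℝ x f) ∂P = ∫ x, Real.exp (inner ℝ x f) ∂Q) : P = Q := by
  refine Measure.ext_of_charFun (funext fun f => ?_)
  have hmgf : mgf (fun x => inner ℝ x f) P = mgf (fun x => inner ℝ x f) Q := by
    ext t
    simpa only [mgf, inner_smul_right] using h (t • f)
  -- For nonzero measures, the mgf vanishes exactly where the exponential is not integrable, so
  -- integrability carries over to `Q`; the zero measure is handled by total mass.
  have h0 : P = 0 ↔ Q = 0 := by
    have := h 0
    simp only [inner_zero_right, Real.exp_zero, integral_const, smul_eq_mul, mul_one] at this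
    rw [← Measure.measure_univ_eq_zero, ← measureReal_eq_zero_iff, this, measureReal_eq_zero_iff,
      Measure.measure_univ_eq_zero]
  have hset : integrableExpSet (fun x => inner ℝ x f) P = Set.univ := by
    refine Set.eq_univ_of_forall fun t => ?_
    simpa only [integrableExpSet, Set.mem_ofPred_eq, inner_smul_right] using hP (t • f)
  -- The strip of analyticity is all of `ℂ`; the value at `I` is the characteristic function.
  have key := eqOn_complexMGF_of_mgf' hmgf h0 (x := Complex.I) (by simp [hset])
  simpa only [complexMGF, charFun_apply, mul_comm Complex.I] using key

theorem _root_.MeasureTheory.Measure.ext_of_integral_gaussianKernel {c : ℝ} (hc : 0 < c)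
    {P Q : Measure H} [IsFiniteMeasure P] [IsFiniteMeasure Q]
    (h : ∀ f : H, ∫ x, gaussianKernel H c x f ∂P = ∫ x, gaussianKernel H c x f ∂Q) : P = Q := by
  set w : H → ENNReal := fun x => ENNReal.ofReal (Real.exp (-c * ‖x‖ ^ 2)) with hw
  have hwm : Measurable w := by fun_prop
  have hw0 : ∀ x, w x ≠ 0 := fun x => by simp [hw, Real.exp_pos]
  have hwt : ∀ x, w x ≠ ⊤ := fun x => ENNReal.ofReal_ne_top
  have hwr : ∀ x, (w x).toReal = Real.exp (-c * ‖x‖ ^ 2) := fun x =>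
    ENNReal.toReal_ofReal (Real.exp_pos _).le
  have hfin : ∀ (μ : Measure H) [IsFiniteMeasure μ], IsFiniteMeasure (μ.withDensity w) := by
    intro μ _
    refine isFiniteMeasure_withDensity_ofReal (Integrable.of_bound (C := 1) (by fun_prop)
      (Filter.Eventually.of_forall fun x => ?_)).2
    rw [Real.norm_of_nonneg (Real.exp_pos _).le, Real.exp_le_one_iff]
    nlinarith [sq_nonneg ‖x‖]
  -- Completing the square: the exponential with parameter `f` is, after weighting, a Gaussian
  -- centred at `f / (2c)`.
  have hexp : ∀ f x : H, (w x).toReal * Real.exp (inner ℝ x f) =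
      Real.exp (c * ‖(2 * c)⁻¹ • f‖ ^ 2) * gaussianKernel H c x ((2 * c)⁻¹ • f) := by
    intro f x
    rw [hwr, gaussianKernel_eq, inner_smul_right, ← Real.exp_add, ← Real.exp_add, ← Real.exp_add,
      ← Real.exp_add]
    congr 1
    field_simp
    ring
  have hexp_int : ∀ (μ : Measure H) (f : H), ∫ x, Real.exp (inner ℝ x f) ∂(μ.withDensity w) =
      Real.exp (c * ‖(2 * c)⁻¹ • f‖ ^ 2) * ∫ x, gaussianKernel H c x ((2 * c)⁻¹ • f) ∂μ := by
    intro μ f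
    rw [integral_withDensity_eq_integral_toReal_smul hwm
      (Filter.Eventually.of_forall fun x => (hwt x).lt_top), ← integral_const_mul]
    simp only [smul_eq_mul, hexp]
  have key : P.withDensity w = Q.withDensity w := by
    have := hfin P
    have := hfin Q
    refine Measure.ext_of_integral_exp_inner (fun f => ?_) fun f => by rw [hexp_int, hexp_int, h]
    rw [integrable_withDensity_iff_integrable_smul' hwm
      (Filter.Eventually.of_forall fun x => (hwt x).lt_top)]
    simp only [smul_eq_mul, hexp]
    refine Integrable.const_mul (Integrable.of_bound (C := 1) ?_
      (Filter.Eventually.of_forall fun x => ?_)) _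
    · exact ((continuous_gaussianKernel c).comp
        (continuous_id.prodMk continuous_const)).aestronglyMeasurable
    · rw [Real.norm_of_nonneg (gaussianKernel_pos c _ _).le]
      exact gaussianKernel_le_one hc.le _ _
  -- The weight is nowhere zero or infinite, so it can be divided out.
  rw [← withDensity_inv_same hwm (Filter.Eventually.of_forall hw0) (μ := P)
    (Filter.Eventually.of_forall hwt), key, withDensity_inv_same hwm
    (Filter.Eventually.of_forall hw0) (Filter.Eventually.of_forall hwt)]

omit [CompleteSpace H] [SecondCountableTopology H] [InnerProductSpace ℝ H] in
-- The Borel σ-algebra of an induced topology is the pulled-back one, so every measurable set is a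
-- preimage, even if `ι` is not injective.
theorem _root_.Topology.IsInducing.measure_map_injective {Z : Type*} [TopologicalSpace Z]
    [MeasurableSpace Z] [BorelSpace Z] {ι : Z → H} (hι : Topology.IsInducing ι) {P Q : Measure Z}
    (h : P.map ι = Q.map ι) : P = Q := by
  ext s hs
  obtain ⟨t, ht, rfl⟩ : MeasurableSet[MeasurableSpace.comap ι inferInstance] s := by
    rwa [BorelSpace.measurable_eq (α := H), ← borel_comap, ← hι.eq_induced,
      ← BorelSpace.measurable_eq (α := Z)]
  rw [← Measure.map_apply hι.continuous.measurable ht, h,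
    Measure.map_apply hι.continuous.measurable ht]

theorem _root_.Topology.IsInducing.measure_ext_of_integral_featureMap {Z : Type*}
    [TopologicalSpace Z] [MeasurableSpace Z] [BorelSpace Z] {ι : Z → H}
    (hι : Topology.IsInducing ι) {c : ℝ} (hc : 0 < c) [IsKernel (gaussianKernel H c)]
    {P Q : Measure Z} [IsFiniteMeasure P] [IsFiniteMeasure Q]
    (h : ∫ z, featureMap (gaussianKernel H c) (ι z) ∂P =
      ∫ z, featureMap (gaussianKernel H c) (ι z) ∂Q) : P = Q := by
  have : SecondCountableTopology Z := hι.secondCountableTopology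
  refine hι.measure_map_injective (Measure.ext_of_integral_gaussianKernel hc fun f => ?_)
  have hi : ∀ (μ : Measure Z) [IsFiniteMeasure μ],
      ∫ x, gaussianKernel H c x f ∂(μ.map ι) =
        inner ℝ (featureMap (gaussianKernel H c) f)
          (∫ z, featureMap (gaussianKernel H c) (ι z) ∂μ) := by
    intro μ _
    rw [← integral_inner (integrable_featureMap_comp (continuous_gaussianKernel c)
      (fun x => gaussianKernel_le_one hc.le x x) hι.continuous μ),
      integral_map hι.continuous.measurable.aemeasurable]
    · simp only [inner_featureMap_featureMap]
      simp only [IsKernel.symm (k := gaussianKernel H c) f]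
    · exact ((continuous_gaussianKernel c).comp
        (continuous_id.prodMk continuous_const)).aestronglyMeasurable
  rw [hi P, hi Q, h]

end Injectivity

/-! ### Embedding of sets into `L²`. -/

section Embedding

variable {d : ℕ} (X : Compacts (EuclideanSpace ℝ (Fin d)))

/-- The class of a set is mapped to its indicator function in `L²`. -/
def LStar.indicatorLp (γ : LStar X) :
    Lp ℝ 2 (volume : Measure (EuclideanSpace ℝ (Fin d))) :=
  indicatorConstLp 2 (measurableSet_toMeasurable volume (Quotient.out γ).1)
    (by
      rw [measure_toMeasurable]
      exact ((measure_mono (Quotient.out γ).2.1).trans_lt X.isCompact.measure_lt_top).ne) 1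

theorem LStar.norm_indicatorLp_sub_sq (γ₁ γ₂ : LStar X) :
    ‖indicatorLp X γ₁ - indicatorLp X γ₂‖ ^ 2 = dist γ₁ γ₂ := by
  have hd : dist γ₁ γ₂ = dist (Quotient.out γ₁) (Quotient.out γ₂) := by
    conv_lhs => rw [← Quotient.out_eq γ₁, ← Quotient.out_eq γ₂]
    rfl
  rw [hd, LSets.dist_def, ← dist_eq_norm, indicatorLp, indicatorLp,
    dist_indicatorConstLp_eq_norm, norm_indicatorConstLp (by simp) (by simp)]
  -- Representatives are only null-measurable, but agree almost everywhere with their measurable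
  -- hulls.
  have e := ((Quotient.out γ₁).2.2.toMeasurable_ae_eq.symmDiff
    (Quotient.out γ₂).2.2.toMeasurable_ae_eq)
  rw [measureReal_def, measure_congr e, norm_one, one_mul, ENNReal.toReal_ofNat, one_div,
    ← Real.rpow_natCast, ← Real.rpow_mul ENNReal.toReal_nonneg]
  norm_num

theorem LStar.isInducing_indicatorLp : Topology.IsInducing (indicatorLp X) := by
  refine (Metric.isUniformInducing_iff.2 ⟨Metric.uniformContinuous_iff.2 fun ε hε =>
    ⟨ε ^ 2, by positivity, fun {a b} h => ?_⟩, fun δ hδ => ⟨√δ, by positivity,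
      fun {a b} h => ?_⟩⟩).isInducing
  · rw [← norm_indicatorLp_sub_sq, ← dist_eq_norm] at h
    exact lt_of_pow_lt_pow_left₀ 2 hε.le h
  · rw [← norm_indicatorLp_sub_sq, ← dist_eq_norm]
    exact (Real.lt_sqrt dist_nonneg).1 h

theorem kset_eq_gaussianKernel (σ : ℝ) (γ₁ γ₂ : LStar X) :
    kset X σ γ₁ γ₂ = gaussianKernel _ (2 * σ ^ 2)⁻¹ (LStar.indicatorLp X γ₁)
      (LStar.indicatorLp X γ₂) := by
  rw [kset, gaussianKernel, LStar.norm_indicatorLp_sub_sq]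
  congr 1
  ring

end Embedding

end SetKernel

end

theorem mainTheorem1 (d : ℕ) (X : TopologicalSpace.Compacts (EuclideanSpace ℝ (Fin d)))
    (σ : ℝ) (hσ : 0 < σ) :
    SetKernel.IsIntegrallyStrictlyPosDef (SetKernel.kset X σ) ∧
      SetKernel.IsCharacteristic (SetKernel.kset X σ) := by
  let H := Lp ℝ 2 (volume : Measure (EuclideanSpace ℝ (Fin d)))
  let _ : MeasurableSpace H := borel H
  have : BorelSpace H := ⟨rfl⟩
  -- The finite exponent makes `L²` second countable.
  have : Fact ((2 : ENNReal) ≠ ⊤) := ⟨by norm_num⟩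
  have hι := SetKernel.LStar.isInducing_indicatorLp X
  have hc : 0 < (2 * σ ^ 2)⁻¹ := by positivity
  set c := (2 * σ ^ 2)⁻¹
  have hk : SetKernel.kset X σ = fun γ₁ γ₂ => SetKernel.gaussianKernel H c
      (SetKernel.LStar.indicatorLp X γ₁) (SetKernel.LStar.indicatorLp X γ₂) :=
    funext₂ fun _ _ => SetKernel.kset_eq_gaussianKernel X σ _ _
  have : SecondCountableTopology (SetKernel.LStar X) := hι.secondCountableTopology
  have hG : SetKernel.IsKernel (SetKernel.gaussianKernel H c) :=
    SetKernel.isKernel_gaussianKernel hc.le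
  have hK : SetKernel.IsKernel (SetKernel.kset X σ) := hk ▸ hG.comap _
  have hcont : Continuous (Function.uncurry (SetKernel.kset X σ)) := by
    rw [hk]
    exact (SetKernel.continuous_gaussianKernel c).comp
      ((hι.continuous.comp continuous_fst).prodMk (hι.continuous.comp continuous_snd))
  have hle : ∀ x y, SetKernel.kset X σ x y ≤ 1 := fun x y => by
    rw [hk]
    exact SetKernel.gaussianKernel_le_one hc.le _ _
  have hΨ : ∀ (μ : Measure (SetKernel.LStar X)) [IsFiniteMeasure μ],
      Integrable (fun γ => SetKernel.featureMap (SetKernel.gaussianKernel H c)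
        (SetKernel.LStar.indicatorLp X γ)) μ := fun μ _ =>
    SetKernel.integrable_featureMap_comp (SetKernel.continuous_gaussianKernel c)
      (fun x => SetKernel.gaussianKernel_le_one hc.le x x) hι.continuous μ
  have hΦ : ∀ (μ : Measure (SetKernel.LStar X)) [IsFiniteMeasure μ],
      Integrable (SetKernel.featureMap (SetKernel.kset X σ)) μ := fun μ _ =>
    SetKernel.integrable_featureMap_comp hcont (fun x => hle x x) continuous_id μ
  have hin : ∀ x y, SetKernel.kset X σ x y =
      inner ℝ (SetKernel.featureMap (SetKernel.gaussianKernel H c)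
        (SetKernel.LStar.indicatorLp X x)) (SetKernel.featureMap (SetKernel.gaussianKernel H c)
        (SetKernel.LStar.indicatorLp X y)) := fun x y => by
    rw [SetKernel.inner_featureMap_featureMap, hk]
  refine ⟨⟨hcont.measurable, ⟨1, fun x y => ?_⟩, fun ν hν => ?_⟩, hK, fun P => hΦ P,
    fun P Q h => ?_⟩
  · exact (abs_of_pos (Real.exp_pos _)).trans_le (hle x y)
  · simp only [hin]
    rw [SetKernel.double_integral_signedMeasure ν (hΨ _) (hΨ _)]
    refine pow_pos (norm_pos_iff.2 fun h => hν ?_) 2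
    -- Equal Jordan parts cancel, forcing `ν = 0`.
    have e := hι.measure_ext_of_integral_featureMap hc (sub_eq_zero.1 h)
    rw [← ν.toSignedMeasure_toJordanDecomposition, JordanDecomposition.toSignedMeasure]
    simp only [e, sub_self]
  · have : IsProbabilityMeasure P.1 := P.2
    have : IsProbabilityMeasure Q.1 := Q.2
    refine Subtype.ext (hι.measure_ext_of_integral_featureMap hc
      (SetKernel.integral_eq_integral_of_inner_eq (hΦ _) (hΦ _) (hΨ _) (hΨ _) (fun x y => ?_) h))
    rw [SetKernel.inner_featureMap_featureMap, hin]
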